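/- Let $\mathbb F_q$ be a finite field with algebraic closure $\overline{\mathbb F}_q$. Let $\mathcal M$ be the set of monomials in $X_1,\dots,X_m$, and let $w:\mathcal M\to\mathbb N_0^r$ satisfy $w(MN)=w(M)+w(N)$. Let $\prec_w$ be the generalized weighted degree ordering on $\mathcal M$: monomials are compared by their weights with respect to a fixed monomial ordering on $\mathbb N_0^r$, and ties are broken by a fixed monomial ordering on $\mathcal M$. For an ideal $J$ let $\Delta_{\prec_w}(J)$ be its footprint, i.e. the set of monomials that are not the leading monomial of any nonzero polynomial of $J$. Let $I\subseteq\mathbb F_q[X_1,\dots,X_m]$ be an ideal such that $(I,\prec_w)$ satisfies the order domain conditions: (i) $I$ has a Gröbner basis with respect to $\prec_w$ each of whose elements has exactly two monomials of highest weight in its support; (ii) no two distinct monomials of $\Delta_{\prec_w}(I)$ have the same weight. Let $\mathcal P=\{P_1,\dots,P_h\}\subseteq\overline{\mathbb F}_q^{\,m}$ be a set of $h$ distinct common zeros of $I$, and let $r_i=\deg P_i$ be the least positive integer such that $P_i$ is $\mathbb F_{q^{r_i}}$-rational. Let $\mathbb F_q\subseteq K\subseteq\overline{\mathbb F}_q$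 be a field and $J\subseteq K[X_1,\dots,X_m]$ an ideal such that $I_{\mathcal P}:=I\,K[X_1,\dots,X_m]+J$ is the ideal of all polynomials over $K$ that vanish on $\mathcal P$, and such that the zero set of $I_{\mathcal P}$ in $\overline{\mathbb F}_q^{\,m}$ is exactly $\mathcal P$. (If $\mathcal P$ is stable under the Frobenius map $x\mapsto x^q$, one may take $K=\mathbb F_q$; for any $\mathcal P$ one may take $K=\overline{\mathbb F}_q$ or any finite $K$ containing all the coordinates of the points.) Let $L\subseteq K[X_1,\dots,X_m]/I_{\mathcal P}$ be an $\mathbb F_q$-subspace with a well-behaving basis $b_1+I_{\mathcal P},\dots,b_k+I_{\mathcal P}$ over $\mathbb F_q$, that is, one with $b_j\in\mathbb F_q[X_1,\dots,X_m]$, $\mathrm{Supp}(b_j)\subseteq\Delta_{\prec_w}(I_{\mathcal P})$ for all $j$, and $\mathrm{lm}(b_1)\prec_w\cdots\prec_w\mathrm{lm}(b_k)$. Put $\square(L)=\{\mathrm{lm}(b_1),\dots,\mathrm{lm}(b_k)\}$. For $i=1,\dots,h$ let $C_i\subseteq\mathbb F_q^{n_i}$ be a linear $[n_i,r_i,d_i]$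 code and $\pi_i:\mathbb F_{q^{r_i}}\to C_i$ an $\mathbb F_q$-linear isomorphism. Let $C(I,L,\mathcal P,\mathcal C)\subseteq\mathbb F_q^{n_1+\cdots+n_h}$ be the extended affine-variety code, consisting of the words $(\pi_1(f(P_1)),\dots,\pi_h(f(P_h)))$ with $f\in\mathbb F_q[X_1,\dots,X_m]$ and $f+I_{\mathcal P}\in L$. Put $\Gamma=w(\Delta_{\prec_w}(I))$, $\Delta=\Delta_{\prec_w}(I_{\mathcal P})$ and, for $\lambda\in w(\Delta)$, $\sigma(\lambda)=|\{\eta\in w(\Delta):\eta-\lambda\in\Gamma\}|$. Then the minimum distance of $C(I,L,\mathcal P,\mathcal C)$ is at least $$\delta\,\hat d,\qquad \delta=\min\{\sigma(w(\alpha)):\alpha\in\square(L)\},\quad \hat d=\min\{d_1,\dots,d_h\}.$$ (For $L=0$ the code has no two distinct words, its minimum distance is read as $+\infty$, and there is nothing to prove.) -/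

import Mathlib

namespace ExtCode

/-! ### Generalized weighted degree orderings -/

/-- A copy of the monoid of monomials in `m` variables (exponent vectors), carrying the
generalized weighted degree ordering given by `w`, `ordN`, `ordM`. -/
def WSyn {m r : ℕ} (_w : (Fin m →₀ ℕ) →+ (Fin r →₀ ℕ))
    (_ordN : MonomialOrder (Fin r)) (_ordM : MonomialOrder (Fin m)) : Type := Fin m →₀ ℕ

section WSyn

variable {m r : ℕ} (w : (Fin m →₀ ℕ) →+ (Fin r →₀ ℕ))
  (ordN : MonomialOrder (Fin r)) (ordM : MonomialOrder (Fin m))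

noncomputable instance : AddCommMonoid (WSyn w ordN ordM) :=
  inferInstanceAs (AddCommMonoid (Fin m →₀ ℕ))

/-- The pair (weight, monomial), in the lexicographic product of the two orderings. -/
noncomputable def WSyn.key (a : WSyn w ordN ordM) : ordN.syn ×ₗ ordM.syn :=
  toLex (ordN.toSyn (w a), ordM.toSyn a)

theorem WSyn.key_injective : Function.Injective (WSyn.key w ordN ordM) := by
  intro a b h
  have h2 := congrArg (fun x => (ofLex x).2) h
  exact ordM.toSyn.injective h2

noncomputable instance : LinearOrder (WSyn w ordN ordM) :=
  LinearOrder.lift' (WSyn.key w ordN ordM) (WSyn.key_injective w ordN ordM)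

theorem WSyn.le_iff (a b : WSyn w ordN ordM) :
    a ≤ b ↔ ordN.toSyn (w a) < ordN.toSyn (w b) ∨
      (ordN.toSyn (w a) = ordN.toSyn (w b) ∧ ordM.toSyn a ≤ ordM.toSyn b) :=
  Prod.Lex.toLex_le_toLex

instance : IsOrderedAddMonoid (WSyn w ordN ordM) where
  add_le_add_left a b h c := by
    rw [WSyn.le_iff] at h ⊢
    have e (x y : WSyn w ordN ordM) : w (x + y) = w x + w y := map_add w x y
    have e' (x y : WSyn w ordN ordM) :
      ordM.toSyn (x + y) = ordM.toSyn x + ordM.toSyn y := map_add ordM.toSyn x y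
    simp only [e, e', map_add]
    rcases h with h | ⟨h, h'⟩
    · left; gcongr
    · right; exact ⟨by rw [h], by gcongr⟩

instance : WellFoundedLT (WSyn w ordN ordM) := by
  have h : WellFounded (fun x y : ordN.syn ×ₗ ordM.syn => x < y) := wellFounded_lt
  exact ⟨InvImage.wf (WSyn.key w ordN ordM) h⟩

/-- The generalized weighted degree ordering `≺_w`: monomials are compared by their weights
with respect to the monomial ordering `ordN` on `ℕ^r`; ties are broken by the monomial
ordering `ordM`. The weight `w` is additive, i.e. it is determined by the weights of the
variables. -/
noncomputable def weightedOrder : MonomialOrder (Fin m) where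
  syn := WSyn w ordN ordM
  toSyn :=
    { toFun := fun a => a
      invFun := fun a => a
      left_inv := fun _ => rfl
      right_inv := fun _ => rfl
      map_add' := fun _ _ => rfl }
  toSyn_monotone a b h := by
    refine (WSyn.le_iff w ordN ordM _ _).2 ?_
    have hw : w a ≤ w b := by
      rw [← add_tsub_cancel_of_le h, map_add]
      exact le_self_add
    rcases (ordN.toSyn_monotone hw).lt_or_eq with h1 | h1
    · exact Or.inl h1
    · exact Or.inr ⟨h1, ordM.toSyn_monotone h⟩

end WSyn

/-! ### Footprints, Gröbner bases and the order domain conditions -/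

section OrderDomain

variable {m r : ℕ} {K : Type*} [Field K]

/-- The footprint `Δ_≺(J)`: the monomials that are not the leading monomial of any
(nonzero) polynomial of `J`. -/
def footprint (ord : MonomialOrder (Fin m)) (J : Ideal (MvPolynomial (Fin m) K)) :
    Set (Fin m →₀ ℕ) :=
  {a | ∀ f ∈ J, f ≠ 0 → ord.degree f ≠ a}

/-- `G` is a Gröbner basis of `I`: a finite subset of `I` such that the leading monomial of
every nonzero element of `I` is divisible by the leading monomial of some nonzero element
of `G`. -/
def IsGroebnerBasis (ord : MonomialOrder (Fin m)) (I : Ideal (MvPolynomial (Fin m) K))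
    (G : Set (MvPolynomial (Fin m) K)) : Prop :=
  G.Finite ∧ G ⊆ I ∧
    ∀ f ∈ I, f ≠ 0 → ∃ g ∈ G, g ≠ 0 ∧ ord.degree g ≤ ord.degree f

/-- The monomials of highest weight in the support of `g`. -/
def topWeightMonomials (w : (Fin m →₀ ℕ) →+ (Fin r →₀ ℕ)) (ordN : MonomialOrder (Fin r))
    (g : MvPolynomial (Fin m) K) : Set (Fin m →₀ ℕ) :=
  {a | a ∈ g.support ∧ ∀ b ∈ g.support, ordN.toSyn (w b) ≤ ordN.toSyn (w a)}

/-- The pair `(I, ≺_w)` satisfies the order domain conditions. -/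
def OrderDomainConditions (w : (Fin m →₀ ℕ) →+ (Fin r →₀ ℕ)) (ordN : MonomialOrder (Fin r))
    (ordM : MonomialOrder (Fin m)) (I : Ideal (MvPolynomial (Fin m) K)) : Prop :=
  (∃ G : Set (MvPolynomial (Fin m) K), IsGroebnerBasis (weightedOrder w ordN ordM) I G ∧
    ∀ g ∈ G, (topWeightMonomials w ordN g).ncard = 2) ∧
  Set.InjOn w (footprint (weightedOrder w ordN ordM) I)

/-- `σ(lam) = |{η ∈ w(Δ) : η - lam ∈ Γ}|`, where `wΔ` stands for `w(Δ)`. -/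
noncomputable def sigma (wΔ Γ : Set (Fin r →₀ ℕ)) (lam : Fin r →₀ ℕ) : ℕ :=
  {η | η ∈ wΔ ∧ ∃ γ ∈ Γ, η = lam + γ}.ncard

end OrderDomain

/-! ### Subspaces of the coordinate ring and well-behaving bases -/

section WellBehaving

variable {F : Type*} [Field F] {K : Type*} [Field K] [Algebra F K] {m : ℕ}

/-- The residue class map `F[X] → K[X] / J`, `f ↦ f + J`, for an extension `K` of `F` and an
ideal `J` of `K[X]`. For `K = F` it is the usual quotient map. -/
noncomputable def residue (J : Ideal (MvPolynomial (Fin m) K)) :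
    MvPolynomial (Fin m) F →ₐ[F] (MvPolynomial (Fin m) K ⧸ J) :=
  (Ideal.Quotient.mkₐ F J).comp (MvPolynomial.mapAlgHom (Algebra.ofId F K))

/-- The classes `b_1 + J, …, b_k + J` form a basis over `F` of the space `L`, which is
well-behaving with respect to `ord`. -/
structure IsWellBehavingBasis (ord : MonomialOrder (Fin m))
    (J : Ideal (MvPolynomial (Fin m) K)) (L : Submodule F (MvPolynomial (Fin m) K ⧸ J))
    {k : ℕ} (b : Fin k → MvPolynomial (Fin m) F) : Prop where
  linearIndependent : LinearIndependent F (fun i => residue J (b i))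
  span_eq : Submodule.span F (Set.range (fun i => residue J (b i))) = L
  support_subset : ∀ i, (↑(b i).support : Set (Fin m →₀ ℕ)) ⊆ footprint ord J
  strictMono_lm : StrictMono (fun i => ord.toSyn (ord.degree (b i)))

/-- The set `□(L)` of leading monomials of a well-behaving basis. -/
def square (ord : MonomialOrder (Fin m)) {k : ℕ} (b : Fin k → MvPolynomial (Fin m) F) :
    Set (Fin m →₀ ℕ) :=
  Set.range (fun i => ord.degree (b i))

end WellBehaving

/-! ### Points of arbitrary degree -/

section Points

variable (F : Type*) [Field F] [Finite F] {Ω : Type*} [Field Ω] [Algebra F Ω]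

variable (Ω) in
/-- For `F = 𝔽_q` with algebraic closure `Ω` and `n ≥ 1`: the subfield `𝔽_{q^n}` of `Ω`,
i.e. the set of all `x` with `x ^ (q ^ n) = x`. -/
noncomputable def gf (n : ℕ) : IntermediateField F Ω :=
  have hadd : ∀ x y : Ω, (x + y) ^ (Nat.card F ^ n) =
      x ^ (Nat.card F ^ n) + y ^ (Nat.card F ^ n) := by
    intro x y
    have := Fintype.ofFinite F
    obtain ⟨p, hp⟩ := CharP.exists F
    obtain ⟨e, hprime, he⟩ := FiniteField.card F p
    have : Fact p.Prime := ⟨hprime⟩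
    have : CharP Ω p := charP_of_injective_algebraMap (algebraMap F Ω).injective p
    rw [Nat.card_eq_fintype_card, he, ← pow_mul]
    exact add_pow_char_pow x y p _
  have halg : ∀ a : F, algebraMap F Ω a ^ (Nat.card F ^ n) = algebraMap F Ω a := by
    intro a
    have := Fintype.ofFinite F
    rw [← map_pow, Nat.card_eq_fintype_card, FiniteField.pow_card_pow]
  { carrier := {x | x ^ (Nat.card F ^ n) = x}
    mul_mem' := fun {x y} hx hy => by
      simp only [Set.mem_ofPred_eq] at hx hy ⊢
      rw [mul_pow, hx, hy]
    add_mem' := fun {x y} hx hy => by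
      simp only [Set.mem_ofPred_eq] at hx hy ⊢
      rw [hadd, hx, hy]
    algebraMap_mem' := halg
    inv_mem' := fun x hx => by
      simp only [Set.mem_ofPred_eq, inv_pow] at hx ⊢
      rw [hx] }

theorem mem_gf_iff (n : ℕ) (x : Ω) : x ∈ gf F Ω n ↔ x ^ (Nat.card F ^ n) = x := Iff.rfl

/-- The degree of a point `P` with coordinates in `Ω`: the least positive integer `n` such
that `P` is `𝔽_{q^n}`-rational. -/
noncomputable def pointDegree {m : ℕ} (P : Fin m → Ω) : ℕ :=
  sInf {n : ℕ | 0 < n ∧ ∀ j, P j ∈ gf F Ω n}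

theorem pointDegree_spec [IsAlgClosure F Ω] {m : ℕ} (P : Fin m → Ω) :
    0 < pointDegree F P ∧ ∀ j, P j ∈ gf F Ω (pointDegree F P) := by
  have : Algebra.IsAlgebraic F Ω := IsAlgClosure.isAlgebraic
  refine Nat.sInf_mem (s := {n : ℕ | 0 < n ∧ ∀ j, P j ∈ gf F Ω n}) ?_
  let E := IntermediateField.adjoin F (Set.range P)
  have : FiniteDimensional F E :=
    IntermediateField.finiteDimensional_adjoin fun x _ => Algebra.IsIntegral.isIntegral x
  have : Finite E := Module.finite_of_finite F
  have := Fintype.ofFinite E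
  refine ⟨Module.finrank F E, Module.finrank_pos, fun j => ?_⟩
  have hj : P j ∈ E := IntermediateField.subset_adjoin F _ ⟨j, rfl⟩
  rw [mem_gf_iff, ← Module.natCard_eq_pow_finrank, Nat.card_eq_fintype_card]
  exact congrArg Subtype.val (FiniteField.pow_card (⟨P j, hj⟩ : E))

/-- Evaluation `f ↦ f(P)` of polynomials over `𝔽_q` at a point `P` of degree `r`, with values
in `𝔽_{q^r}`. -/
noncomputable def evalPoint [IsAlgClosure F Ω] {m : ℕ} (P : Fin m → Ω) :
    MvPolynomial (Fin m) F →ₐ[F] gf F Ω (pointDegree F P) :=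
  MvPolynomial.aeval (fun j => ⟨P j, (pointDegree_spec F P).2 j⟩)

theorem coe_evalPoint [IsAlgClosure F Ω] {m : ℕ} (P : Fin m → Ω)
    (f : MvPolynomial (Fin m) F) : (evalPoint F P f : Ω) = MvPolynomial.aeval P f := by
  induction f using MvPolynomial.induction_on with
  | C a => simp [evalPoint]
  | add p q hp hq => simp [hp, hq]
  | mul_X p j hp => simp [hp]; left; simp [evalPoint]

end Points

/-! ### Codes -/

section Codes

variable {F : Type*} [Field F]

open Classical in
/-- The minimum distance of a linear code: the least Hamming distance between two distinct
codewords (`⊤` for the zero code, which has no such pair). -/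
noncomputable def minDist {ι : Type*} [Fintype ι] (C : Submodule F (ι → F)) : ℕ∞ :=
  ⨅ (x ∈ C) (y ∈ C) (_ : x ≠ y), (hammingDist x y : ℕ∞)

variable [Finite F] {Ω : Type*} [Field Ω] [Algebra F Ω] [IsAlgClosure F Ω]

/-- The map `f ↦ (π_1(f(P_1)), …, π_h(f(P_h)))` into `𝔽_q^n`, `n = n_1 + ⋯ + n_h`; the
coordinates are indexed by the pairs `(i, j)` with `i ≤ h` and `j ≤ n_i`. -/
noncomputable def evBar {m h : ℕ} (P : Fin h → Fin m → Ω) {n : Fin h → ℕ}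
    {C : ∀ i, Submodule F (Fin (n i) → F)}
    (π : ∀ i, gf F Ω (pointDegree F (P i)) ≃ₗ[F] C i) :
    MvPolynomial (Fin m) F →ₗ[F] ((Σ i : Fin h, Fin (n i)) → F) :=
  LinearMap.pi fun ij =>
    (LinearMap.proj ij.2).comp ((C ij.1).subtype.comp
      ((π ij.1).toLinearMap.comp (evalPoint F (P ij.1)).toLinearMap))

/-- The extended affine-variety code: the words
`(π_1(f(P_1)), …, π_h(f(P_h)))` for all polynomials `f` over `𝔽_q` with `f + J ∈ L`.
(When `J` vanishes at the points, the word depends only on the class `f + J`.) -/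
noncomputable def extendedCode {K : Type*} [Field K] [Algebra F K] {m h : ℕ}
    {J : Ideal (MvPolynomial (Fin m) K)} (L : Submodule F (MvPolynomial (Fin m) K ⧸ J))
    (P : Fin h → Fin m → Ω) {n : Fin h → ℕ} {C : ∀ i, Submodule F (Fin (n i) → F)}
    (π : ∀ i, gf F Ω (pointDegree F (P i)) ≃ₗ[F] C i) :
    Submodule F ((Σ i : Fin h, Fin (n i)) → F) :=
  (L.comap (residue J : MvPolynomial (Fin m) F →ₐ[F] _).toLinearMap).map (evBar P π)

end Codes

end ExtCode

/-! ### Leading monomials of linear combinations and of scalar extensions. -/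

namespace MonomialOrder

open MvPolynomial

/-! The difference of two distinct codewords is the word of some `g ≠ 0` in the span of the `b_j`,
so `Supp(g) ⊆ Δ(I_P)` and `lm(g) ∈ □(L)`. Each point with `g(P_i) ≠ 0` contributes at least `d_i` to
the weight of the word, so it suffices that at least `σ(w(lm(g)))` points are of this kind
(`sigma_weight_degree_le_card`).

For each `η ∈ w(Δ(I_P))` of the form `w(lm(g)) + w(e)` with `e ∈ Δ(I)`, reduce `X^e g` modulo `I` to
a polynomial `N_η`. Since `w` is injective on `Δ(I) ⊇ Supp(g)`, `X^e g` has a single monomial of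
highest weight, and reduction by binomial-like Gröbner basis elements keeps both this property and
the weight (`exists_isTopMonomial_mem_footprint`). Hence `lm(N_η)` is the unique monomial of `Δ(I)`
of weight `η`, and it lies in `Δ(I_P)`. At the points, `N_η` agrees with `X^e g`, so it vanishes
wherever `g` does. If the `N_η` are independent over `Ω` as functions on the points, their number is
at most the number of points where `g ≠ 0`.

Independence over `F` would not suffice to count points, as the values lie in `Ω`. A vanishing
combination over `Ω` has its leading monomial in `Δ(I_P)`, a footprint defined over `K`; Galois
descent (`exists_mem_vanishingIdeal_degree_eq`) turns it into an element of `I_P` with the same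
leading monomial, a contradiction. -/

theorem degree_eq_of_mem_support_of_forall_le {σ R : Type*} [CommSemiring R]
    (ord : MonomialOrder σ) {f : MvPolynomial σ R} {a : σ →₀ ℕ} (ha : a ∈ f.support)
    (hle : ∀ b ∈ f.support, ord.toSyn b ≤ ord.toSyn a) : ord.degree f = a := by
  have hf : f ≠ 0 := by rintro rfl; simp at ha
  exact ord.toSyn.injective (le_antisymm (hle _ (ord.degree_mem_support hf)) (ord.le_degree ha))

theorem degree_map_of_injective {σ R S : Type*} [CommSemiring R] [CommSemiring S]
    (ord : MonomialOrder σ) {φ : R →+* S} (hφ : Function.Injective φ) (f : MvPolynomial σ R) :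
    ord.degree (map φ f) = ord.degree f := by
  simp only [degree, support_map_of_injective f hφ]

/-- A nontrivial linear combination of polynomials with distinct degrees is nonzero, and it has
the degree of one of them. -/
theorem exists_degree_sum_smul_eq {σ k ι : Type*} [Field k] [Fintype ι] (ord : MonomialOrder σ)
    {p : ι → MvPolynomial σ k} (hp : ∀ i, p i ≠ 0)
    (hdeg : Function.Injective fun i => ord.degree (p i)) {c : ι → k} (hc : c ≠ 0) :
    ∃ i, ∑ j, c j • p j ≠ 0 ∧ ord.degree (∑ j, c j • p j) = ord.degree (p i) := by
  classical
  obtain ⟨i₀, hi₀⟩ := Function.ne_iff.1 hc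
  -- The largest degree among the terms with nonzero coefficient occurs only once, so it cannot
  -- cancel.
  obtain ⟨i, hi, hmax⟩ := Finset.exists_max_image ({j | c j ≠ 0} : Finset ι)
    (fun j => ord.toSyn (ord.degree (p j))) ⟨i₀, by simpa using hi₀⟩
  simp only [Finset.mem_filter, Finset.mem_univ, true_and] at hi hmax
  have hmem : ord.degree (p i) ∈ (∑ j, c j • p j).support := by
    rw [mem_support_iff, coeff_sum, Finset.sum_eq_single i]
    · simpa [hi] using hp i
    · intro j _ hj
      by_cases hcj : c j = 0
      · simp [hcj]
      · have hlt : ord.toSyn (ord.degree (p j)) < ord.toSyn (ord.degree (p i)) :=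
          lt_of_le_of_ne (hmax j hcj) fun h => hj (hdeg (ord.toSyn.injective h))
        simp [ord.coeff_eq_zero_of_lt hlt]
    · simp
  refine ⟨i, ?_, ord.degree_eq_of_mem_support_of_forall_le hmem fun b hb => ?_⟩
  · intro h
    simp [h] at hmem
  · rw [mem_support_iff, coeff_sum] at hb
    obtain ⟨j, -, hj⟩ := Finset.exists_ne_zero_of_sum_ne_zero hb
    rw [coeff_smul, smul_eq_mul] at hj
    exact (ord.le_degree (mem_support_iff.2 (right_ne_zero_of_mul hj))).trans
      (hmax j (left_ne_zero_of_mul hj))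

end MonomialOrder

namespace ExtCode

open MvPolynomial

/-! ### Galois descent for leading monomials of vanishing ideals -/

section Descent

variable {σ K Ω : Type*} [Field K] [Field Ω] [Algebra K Ω]

theorem comp_mem_zeroLocus {I : Ideal (MvPolynomial σ K)} {x : σ → Ω}
    (hx : x ∈ zeroLocus Ω I) (τ : Ω →ₐ[K] Ω) : τ ∘ x ∈ zeroLocus Ω I := by
  intro p hp
  have h := comp_aeval_apply x τ p
  rw [hx p hp, map_zero] at h
  exact h.symm

/-- The value of `τ f` at `x` is `τ` applied to the value of `f` at `τ⁻¹ x`, and `τ⁻¹` preserves the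
zero set because `I` is defined over `K`. -/
theorem map_mem_vanishingIdeal_zeroLocus {I : Ideal (MvPolynomial σ K)} {f : MvPolynomial σ Ω}
    (hf : f ∈ vanishingIdeal Ω (zeroLocus Ω I)) (τ : Ω ≃ₐ[K] Ω) :
    map (τ : Ω →+* Ω) f ∈ vanishingIdeal Ω (zeroLocus Ω I) := by
  intro x hx
  have h := hf _ (comp_mem_zeroLocus hx (τ.symm : Ω →ₐ[K] Ω))
  have h' := congrArg τ h
  rw [map_zero, aeval_def, eval₂_eq] at h'
  rw [aeval_def, eval₂_eq, support_map_of_injective _ τ.injective, ← h', map_sum]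
  simp [map_prod, coeff_map]

/-- A leading monomial of a polynomial over `Ω` that vanishes on a Galois stable set is the leading
monomial of a polynomial over `K` that vanishes there. -/
theorem exists_mem_vanishingIdeal_degree_eq [IsGalois K Ω] (ord : MonomialOrder σ)
    {I : Ideal (MvPolynomial σ K)} {f : MvPolynomial σ Ω}
    (hf : f ∈ vanishingIdeal Ω (zeroLocus Ω I)) (hf0 : f ≠ 0) :
    ∃ g ∈ vanishingIdeal K (zeroLocus Ω I), g ≠ 0 ∧ ord.degree g = ord.degree f := by
  classical
  set V := vanishingIdeal Ω (zeroLocus Ω I) with hV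
  let S : Set (MvPolynomial σ Ω) := {g | g ∈ V ∧ ord.degree g = ord.degree f ∧
    coeff (ord.degree f) g = 1}
  have hS : S.Nonempty := by
    have hlc : coeff (ord.degree f) f ≠ 0 := by simpa using hf0
    have hc : (coeff (ord.degree f) f)⁻¹ ≠ 0 := inv_ne_zero hlc
    refine ⟨C (coeff (ord.degree f) f)⁻¹ * f, V.mul_mem_left _ hf, ?_, ?_⟩
    · rw [← smul_eq_C_mul]
      exact ord.degree_smul_of_isRegular (IsRegular.of_ne_zero hc)
    · rw [coeff_C_mul, inv_mul_cancel₀ hlc]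
  -- Among the normalized candidates, one with the fewest terms is forced to be Galois invariant.
  obtain ⟨g, ⟨hgV, hgd, hgc⟩, hmin⟩ :=
    exists_minimalFor_of_wellFoundedLT (· ∈ S) (fun g => g.support.card) hS
  have hfix (τ : Ω ≃ₐ[K] Ω) : map (τ : Ω →+* Ω) g = g := by
    by_contra hne
    set u := map (τ : Ω →+* Ω) g - g with hu
    have hu0 : u ≠ 0 := sub_ne_zero.2 hne
    have hcoeff (a : σ →₀ ℕ) : coeff a u = τ (coeff a g) - coeff a g := by
      simp [hu, coeff_map]
    obtain ⟨b, hb⟩ := ne_zero_iff.1 hu0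
    have hbg : coeff b g ≠ 0 := fun h => hb (by simp [hcoeff, h])
    -- The difference `u` has no term at `ord.degree f`, where the coefficient of `g` is the
    -- invariant `1`. Subtracting the multiple of `u` that kills the term at `b` therefore stays in
    -- `S` and shortens the support.
    let g' := g - C (coeff b g / coeff b u) * u
    have hg' (a : σ →₀ ℕ) : coeff a g' = coeff a g - coeff b g / coeff b u * coeff a u := by
      simp [g', coeff_C_mul]
    have hsub : g'.support ⊆ g.support.erase b := by
      intro a ha
      rw [mem_support_iff, hg'] at ha
      refine Finset.mem_erase.2 ⟨?_, mem_support_iff.2 fun h => ha (by simp [hcoeff, h])⟩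
      rintro rfl
      exact ha (by field_simp; simp)
    have hc' : coeff (ord.degree f) g' = 1 := by simp [hg', hcoeff, hgc]
    have hg'S : g' ∈ S := by
      refine ⟨V.sub_mem hgV (V.mul_mem_left _
        (V.sub_mem (map_mem_vanishingIdeal_zeroLocus hgV τ) hgV)), ?_, hc'⟩
      refine ord.degree_eq_of_mem_support_of_forall_le (by simp [hc']) fun a ha => ?_
      rw [← hgd]
      exact ord.le_degree (Finset.mem_of_mem_erase (hsub ha))
    have hlt : g'.support.card < g.support.card :=
      (Finset.card_le_card hsub).trans_lt (Finset.card_erase_lt_of_mem (by simpa using hbg))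
    exact absurd (hmin hg'S hlt.le) (not_le.2 hlt)
  have hrange : g ∈ Set.range (map (σ := σ) (algebraMap K Ω)) := by
    rw [mem_range_map_iff_coeffs_subset]
    intro x hx
    obtain ⟨a, -, rfl⟩ := mem_coeffs_iff.1 hx
    have := (InfiniteGalois.mem_bot_iff_fixed (k := K) (coeff a g)).2 fun τ => by
      conv_rhs => rw [← hfix τ]
      simp [coeff_map]
    exact this
  obtain ⟨g₀, rfl⟩ := hrange
  rw [ord.degree_map_of_injective (algebraMap K Ω).injective] at hgd
  refine ⟨g₀, fun x hx => ?_, ?_, hgd⟩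
  · have := hgV x hx
    rwa [aeval_map_algebraMap] at this
  · rintro rfl
    simp at hgc

/-- Polynomials whose leading monomials are distinct elements of the footprint of the ideal of a
zero set are linearly independent as functions on this set. -/
theorem linearIndependent_aeval_zeroLocus [IsGalois K Ω] {m : ℕ} (ord : MonomialOrder (Fin m))
    {I : Ideal (MvPolynomial (Fin m) K)} (hI : vanishingIdeal K (zeroLocus Ω I) = I)
    {ι : Type*} [Fintype ι] {p : ι → MvPolynomial (Fin m) Ω} (hp : ∀ i, p i ≠ 0)
    (hdeg : Function.Injective fun i => ord.degree (p i))
    (hfoot : ∀ i, ord.degree (p i) ∈ footprint ord I) :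
    LinearIndependent Ω fun i => fun x : zeroLocus Ω I => aeval (x : Fin m → Ω) (p i) := by
  rw [Fintype.linearIndependent_iff]
  intro c hc
  by_contra! hne
  obtain ⟨i, hi0, hi⟩ := ord.exists_degree_sum_smul_eq hp hdeg (Function.ne_iff.2 hne)
  obtain ⟨g, hg, hg0, hgd⟩ := exists_mem_vanishingIdeal_degree_eq (K := K) ord (I := I)
    (f := ∑ j, c j • p j) (fun x hx => by simpa using congrFun hc ⟨x, hx⟩) hi0
  exact hfoot i g (hI ▸ hg) hg0 (hgd.trans hi)

end Descent

/-! ### Reduction modulo an ideal with the order domain conditions -/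

section Reduction

variable {m r : ℕ} {w : (Fin m →₀ ℕ) →+ (Fin r →₀ ℕ)}
  {ordN : MonomialOrder (Fin r)} {ordM : MonomialOrder (Fin m)} {K : Type*} [Field K]

theorem toSyn_weight_le_of_toSyn_le {a b : Fin m →₀ ℕ}
    (h : (weightedOrder w ordN ordM).toSyn a ≤ (weightedOrder w ordN ordM).toSyn b) :
    ordN.toSyn (w a) ≤ ordN.toSyn (w b) := by
  rcases (WSyn.le_iff w ordN ordM _ _).1 h with h | h
  · exact h.le
  · exact h.1.le

theorem toSyn_lt_of_toSyn_weight_lt {a b : Fin m →₀ ℕ}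
    (h : ordN.toSyn (w a) < ordN.toSyn (w b)) :
    (weightedOrder w ordN ordM).toSyn a < (weightedOrder w ordN ordM).toSyn b :=
  lt_of_not_ge fun h' => (toSyn_weight_le_of_toSyn_le h').not_gt h

/-- `a` is the only monomial of highest weight in the support of `f`. -/
def IsTopMonomial (w : (Fin m →₀ ℕ) →+ (Fin r →₀ ℕ)) (ordN : MonomialOrder (Fin r))
    (f : MvPolynomial (Fin m) K) (a : Fin m →₀ ℕ) : Prop :=
  a ∈ f.support ∧ ∀ b ∈ f.support, b ≠ a → ordN.toSyn (w b) < ordN.toSyn (w a)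

theorem IsTopMonomial.degree_eq {f : MvPolynomial (Fin m) K} {a : Fin m →₀ ℕ}
    (h : IsTopMonomial w ordN f a) : (weightedOrder w ordN ordM).degree f = a := by
  refine MonomialOrder.degree_eq_of_mem_support_of_forall_le _ h.1 fun b hb => ?_
  rcases eq_or_ne b a with rfl | hne
  · exact le_rfl
  · exact (toSyn_lt_of_toSyn_weight_lt (h.2 b hb hne)).le

/-- Without ties of weight in the support, the ordering compares its monomials by weight alone. -/
theorem isTopMonomial_degree_of_injOn {f : MvPolynomial (Fin m) K} (hf : f ≠ 0)
    (hw : Set.InjOn w (f.support : Set (Fin m →₀ ℕ))) :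
    IsTopMonomial w ordN f ((weightedOrder w ordN ordM).degree f) := by
  have hmem := (weightedOrder w ordN ordM).degree_mem_support hf
  refine ⟨hmem, fun b hb hne => lt_of_le_of_ne
    (toSyn_weight_le_of_toSyn_le ((weightedOrder w ordN ordM).le_degree hb)) fun h => hne ?_⟩
  exact hw hb hmem (ordN.toSyn.injective h)

theorem IsTopMonomial.mul_monomial {f : MvPolynomial (Fin m) K} {a : Fin m →₀ ℕ}
    (h : IsTopMonomial w ordN f a) (e : Fin m →₀ ℕ) :
    IsTopMonomial w ordN (monomial e 1 * f) (e + a) := by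
  classical
  refine ⟨?_, fun b hb hne => ?_⟩
  · simpa [coeff_monomial_mul] using h.1
  · rw [mem_support_iff, coeff_monomial_mul'] at hb
    split_ifs at hb with hle
    · obtain ⟨b, rfl⟩ := exists_add_of_le hle
      rw [add_tsub_cancel_left, one_mul] at hb
      rw [map_add, map_add, map_add, map_add]
      gcongr
      exact h.2 b (mem_support_iff.2 hb) fun h => hne (h ▸ rfl)
    · simp at hb

/-- If `f` has only one monomial of highest weight, it is congruent modulo `I` to a
polynomial with only one monomial of highest weight, with the same weight, in the footprint. -/
theorem exists_isTopMonomial_mem_footprint {I : Ideal (MvPolynomial (Fin m) K)}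
    (hI : OrderDomainConditions w ordN ordM I) {f : MvPolynomial (Fin m) K} {a : Fin m →₀ ℕ}
    (hf : IsTopMonomial w ordN f a) :
    ∃ g c, f - g ∈ I ∧ IsTopMonomial w ordN g c ∧
      c ∈ footprint (weightedOrder w ordN ordM) I ∧ w c = w a := by
  classical
  obtain ⟨⟨G, ⟨-, hGI, hG⟩, htop⟩, -⟩ := hI
  set ord := weightedOrder w ordN ordM with hord
  -- The top monomial descends along `≺_w` while its weight stays fixed: each step trades it for the
  -- other top-weight monomial of a Gröbner basis element.
  induction hs : ord.toSyn a using WellFoundedLT.induction generalizing f a with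
  | ind s ih =>
    subst hs
    by_cases ha : a ∈ footprint ord I
    · exact ⟨f, a, by simp, hf, ha, rfl⟩
    simp only [footprint, Set.mem_ofPred_eq, not_forall, not_not] at ha
    obtain ⟨f₀, hf₀, hf₀0, rfl⟩ := ha
    obtain ⟨g, hgG, hg0, hle⟩ := hG f₀ hf₀ hf₀0
    have htmem : ord.degree g ∈ topWeightMonomials w ordN g :=
      ⟨ord.degree_mem_support hg0, fun b hb => toSyn_weight_le_of_toSyn_le (ord.le_degree hb)⟩
    obtain ⟨t, ht, hte⟩ : ∃ t, t ≠ ord.degree g ∧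
        topWeightMonomials w ordN g = {ord.degree g, t} := by
      obtain ⟨x, y, hxy, hset⟩ := Set.ncard_eq_two.1 (htop g hgG)
      rw [hset] at htmem ⊢
      rcases htmem with h | h
      · exact ⟨y, h ▸ hxy.symm, by rw [h]⟩
      · rw [Set.mem_singleton_iff] at h
        exact ⟨x, h ▸ hxy, by rw [h, Set.pair_comm]⟩
    have httop : t ∈ topWeightMonomials w ordN g := by simp [hte]
    have hwt : w t = w (ord.degree g) := ordN.toSyn.injective
      (le_antisymm (htmem.2 _ httop.1) (httop.2 _ htmem.1))
    obtain ⟨e, he⟩ := exists_add_of_le hle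
    have htlt : ord.toSyn (e + t) < ord.toSyn (ord.degree f₀) := by
      rw [he, add_comm (ord.degree g), map_add, map_add]
      gcongr
      exact lt_of_le_of_ne (ord.le_degree httop.1) fun h => ht (ord.toSyn.injective h)
    have hwa : w (e + t) = w (ord.degree f₀) := by
      rw [he, map_add, map_add, hwt, add_comm]
    set q := coeff (ord.degree f₀) f / coeff (ord.degree g) g with hq
    have hlg : coeff (ord.degree g) g ≠ 0 := mem_support_iff.1 htmem.1
    have hq0 : q ≠ 0 := div_ne_zero (mem_support_iff.1 hf.1) hlg
    -- `e + t` has the same weight as the top monomial of `f`, so uniqueness keeps it out of `f`;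
    -- the new top term cannot cancel.
    have hetf : coeff (e + t) f = 0 := by
      by_contra h
      have := hf.2 _ (mem_support_iff.2 h) fun h' => htlt.ne (h' ▸ rfl)
      rw [hwa] at this
      exact this.false
    have hf' : IsTopMonomial w ordN (f - monomial e q * g) (e + t) := by
      refine ⟨?_, fun b hb hne => ?_⟩
      · rw [mem_support_iff, coeff_sub, coeff_monomial_mul, hetf, zero_sub, neg_ne_zero]
        exact mul_ne_zero hq0 (mem_support_iff.1 httop.1)
      rw [hwa]
      have hbne : b ≠ ord.degree f₀ := by
        rintro rfl
        rw [mem_support_iff, coeff_sub] at hb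
        nth_rewrite 2 [he] at hb
        rw [add_comm (ord.degree g), coeff_monomial_mul, hq, div_mul_cancel₀ _ hlg, sub_self] at hb
        exact hb rfl
      by_cases hbf : b ∈ f.support
      · exact hf.2 b hbf hbne
      rw [mem_support_iff, coeff_sub, notMem_support_iff.1 hbf, zero_sub, neg_ne_zero,
        coeff_monomial_mul'] at hb
      split_ifs at hb with hle
      · obtain ⟨b, rfl⟩ := exists_add_of_le hle
        rw [add_tsub_cancel_left] at hb
        have hbg : b ∈ g.support := mem_support_iff.2 (right_ne_zero_of_mul hb)
        -- Multiplied by `X^e`, the two top monomials of `g` give the cancelled term and the new top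
        -- term; every other one has smaller weight.
        have hbtop : b ∉ topWeightMonomials w ordN g := by
          rw [hte]
          rintro (rfl | h)
          · exact hbne (by rw [he, add_comm])
          · exact hne (by rw [h])
        have hlt : ordN.toSyn (w b) < ordN.toSyn (w (ord.degree g)) :=
          lt_of_not_ge fun h => hbtop ⟨hbg, fun x hx => (htmem.2 x hx).trans h⟩
        rw [he, add_comm (ord.degree g), map_add, map_add, map_add, map_add]
        gcongr
      · exact absurd rfl hb
    obtain ⟨p, c, hp, hpc, hc, hwc⟩ := ih _ htlt hf' rfl
    refine ⟨p, c, ?_, hpc, hc, hwc.trans hwa⟩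
    have : f - p = (f - monomial e q * g - p) + monomial e q * g := by ring
    rw [this]
    exact I.add_mem hp (I.mul_mem_left _ (hGI hgG))

end Reduction

/-! ### Evaluation at the points -/

section Evaluation

variable {F K Ω : Type*} [Field F] [Field K] [Field Ω] [Algebra F Ω] [Algebra F K] [Algebra K Ω]
  [IsScalarTower F K Ω] {m r : ℕ}

theorem footprint_subset_of_map_le (ord : MonomialOrder (Fin m))
    {I : Ideal (MvPolynomial (Fin m) F)} {J : Ideal (MvPolynomial (Fin m) K)}
    (h : I.map (map (algebraMap F K)) ≤ J) : footprint ord J ⊆ footprint ord I := by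
  intro a ha f hf hf0 hdeg
  refine ha _ (h (Ideal.mem_map_of_mem _ hf)) ?_ ?_
  · rwa [Ne, map_eq_zero_iff _ (map_injective _ (algebraMap F K).injective)]
  · rwa [ord.degree_map_of_injective (algebraMap F K).injective]

theorem aeval_eq_of_map_sub_mem {J : Ideal (MvPolynomial (Fin m) K)} {x : Fin m → Ω}
    (hx : x ∈ zeroLocus Ω J) {f g : MvPolynomial (Fin m) F}
    (h : map (algebraMap F K) (f - g) ∈ J) : aeval x f = aeval x g := by
  have := hx _ h
  rwa [aeval_map_algebraMap, map_sub, sub_eq_zero] at this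

/-- A polynomial supported in the footprint is nonzero at no fewer than
`σ(w(lm(g)))` points. -/
theorem sigma_weight_degree_le_card [IsGalois K Ω]
    {w : (Fin m →₀ ℕ) →+ (Fin r →₀ ℕ)} {ordN : MonomialOrder (Fin r)} {ordM : MonomialOrder (Fin m)}
    {I : Ideal (MvPolynomial (Fin m) F)} (hI : OrderDomainConditions w ordN ordM I)
    {J : Ideal (MvPolynomial (Fin m) K)} (hIJ : I.map (map (algebraMap F K)) ≤ J)
    (hJ : vanishingIdeal K (zeroLocus Ω J) = J)
    {ι : Type*} [Fintype ι] {P : ι → Fin m → Ω} (hP : Function.Injective P)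
    (hzero : zeroLocus Ω J = Set.range P) {g : MvPolynomial (Fin m) F} (hg : g ≠ 0)
    (hsupp : (g.support : Set (Fin m →₀ ℕ)) ⊆ footprint (weightedOrder w ordN ordM) J)
    [DecidablePred fun i => aeval (P i) g ≠ 0] :
    sigma (w '' footprint (weightedOrder w ordN ordM) J) (w '' footprint (weightedOrder w ordN ordM) I)
        (w ((weightedOrder w ordN ordM).degree g)) ≤
      Fintype.card {i // aeval (P i) g ≠ 0} := by
  set ord := weightedOrder w ordN ordM with hord
  have hfoot := footprint_subset_of_map_le ord hIJ
  have htop : IsTopMonomial w ordN g (ord.degree g) :=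
    isTopMonomial_degree_of_injOn hg (hI.2.mono (hsupp.trans hfoot))
  set A := {η | η ∈ w '' footprint ord J ∧
    ∃ γ ∈ w '' footprint ord I, η = w (ord.degree g) + γ} with hA
  change A.ncard ≤ _
  have hN (η : A) : ∃ (e : Fin m →₀ ℕ) (N : MvPolynomial (Fin m) F),
      monomial e 1 * g - N ∈ I ∧ N ≠ 0 ∧ ord.degree N ∈ footprint ord J ∧
        w (ord.degree N) = η := by
    obtain ⟨η, ⟨a, ha, rfl⟩, _, ⟨e, -, rfl⟩, hη⟩ := η
    obtain ⟨N, c, hNI, hNc, hc, hwc⟩ := exists_isTopMonomial_mem_footprint hI (htop.mul_monomial e)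
    have hwca : w c = w a := by rw [hwc, hη, map_add, add_comm]
    -- Both monomials lie in `Δ(I)` and have weight `η`, so condition (ii) identifies them. This
    -- places `lm(N)` in the smaller footprint `Δ(I_P)`.
    obtain rfl : c = a := hI.2 hc (hfoot ha) hwca
    have hdeg : ord.degree N = c := hNc.degree_eq
    refine ⟨e, N, hNI, ?_, by rwa [hdeg], by rw [hdeg]⟩
    rintro rfl
    simpa using hNc.1
  choose e N hNI hN0 hNfoot hNw using hN
  let s : {i // aeval (P i) g ≠ 0} → zeroLocus Ω J :=
    fun i => ⟨P i, hzero ▸ Set.mem_range_self _⟩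
  have hs : Function.Injective s := fun i j hij =>
    Subtype.ext (hP (congrArg Subtype.val hij))
  rcases A.finite_or_infinite with hfin | hinf
  -- `Set.ncard` of an infinite set is `0`, so the bound is trivial in this case.
  swap
  · rw [hinf.ncard]; exact Nat.zero_le _
  have := hfin.fintype
  have hinj := (algebraMap F Ω).injective
  have hli := linearIndependent_aeval_zeroLocus ord hJ (ι := A)
    (p := fun η => map (algebraMap F Ω) (N η))
    (fun η => by rw [Ne, map_eq_zero_iff _ (map_injective _ hinj)]; exact hN0 η)
    (fun η θ h => by
      simp only [ord.degree_map_of_injective hinj] at h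
      exact Subtype.ext (by rw [← hNw, ← hNw, h]))
    (fun η => by rw [ord.degree_map_of_injective hinj]; exact hNfoot η)
  -- The functions `N_η` are the extensions by zero of their restrictions to the points where `g ≠
  -- 0`, so the restrictions are already independent.
  have hli' : LinearIndependent Ω
      fun η : A => fun i : {i // aeval (P i) g ≠ 0} => aeval (P i) (N η) := by
    refine LinearIndependent.of_comp (Function.ExtendByZero.linearMap Ω s) ?_
    convert hli using 1
    ext η ⟨x, hx⟩
    have hxr := hx
    rw [hzero] at hxr
    obtain ⟨i, rfl⟩ := hxr
    simp only [Function.comp_apply, Function.ExtendByZero.linearMap_apply, aeval_map_algebraMap]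
    by_cases hi : aeval (P i) g = 0
    · rw [Function.extend_apply']
      · have hm := aeval_eq_of_map_sub_mem hx (hIJ (Ideal.mem_map_of_mem _ (hNI η)))
        rw [← hm, map_mul, hi, mul_zero, Pi.zero_apply]
      · rintro ⟨j, hj⟩
        exact j.2 (by rw [hP (congrArg Subtype.val hj)]; exact hi)
    · exact hs.extend_apply _ _ (⟨i, hi⟩ : {i // aeval (P i) g ≠ 0})
  rw [← Nat.card_coe_set_eq, Nat.card_eq_fintype_card]
  simpa using hli'.fintype_card_le_finrank

end Evaluation

/-! ### Weights of codewords -/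

section Weights

variable {F : Type*} [Field F]

open Classical in
theorem minDist_le_hammingNorm {ι : Type*} [Fintype ι] {C : Submodule F (ι → F)} {x : ι → F}
    (hx : x ∈ C) (hx0 : x ≠ 0) : minDist C ≤ (hammingNorm x : ℕ∞) := by
  rw [← hammingDist_zero_right]
  exact (iInf₂_le x hx).trans ((iInf₂_le 0 C.zero_mem).trans (iInf_le _ hx0))

open Classical in
theorem hammingNorm_sigma {ι : Type*} [Fintype ι] {n : ι → Type*} [∀ i, Fintype (n i)]
    (x : (Σ i, n i) → F) : hammingNorm x = ∑ i, hammingNorm fun j => x ⟨i, j⟩ := by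
  simp only [hammingNorm]
  rw [← Finset.card_sigma]
  congr 1
  ext ⟨i, j⟩
  simp

variable [Finite F] {Ω : Type*} [Field Ω] [Algebra F Ω] [IsAlgClosure F Ω] {m h : ℕ}

theorem evBar_congr (P : Fin h → Fin m → Ω) {n : Fin h → ℕ}
    {C : ∀ i, Submodule F (Fin (n i) → F)}
    (π : ∀ i, gf F Ω (pointDegree F (P i)) ≃ₗ[F] C i) {f g : MvPolynomial (Fin m) F}
    (hfg : ∀ i, aeval (P i) f = aeval (P i) g) : evBar P π f = evBar P π g := by
  have heq (i) : evalPoint F (P i) f = evalPoint F (P i) g :=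
    Subtype.ext (by rw [coe_evalPoint, coe_evalPoint, hfg])
  ext ⟨i, j⟩
  simp [evBar, heq]

open Classical in
-- A nonzero value at `P_i` is sent by the injective `π_i` to a nonzero word of `C_i`, and the
-- blocks have disjoint coordinates, so their weights add.
theorem card_mul_le_hammingNorm_evBar (P : Fin h → Fin m → Ω) {n : Fin h → ℕ}
    {C : ∀ i, Submodule F (Fin (n i) → F)}
    (π : ∀ i, gf F Ω (pointDegree F (P i)) ≃ₗ[F] C i) (f : MvPolynomial (Fin m) F) :
    (Fintype.card {i // aeval (P i) f ≠ 0} : ℕ∞) * (⨅ i, minDist (C i)) ≤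
      (hammingNorm (evBar P π f) : ℕ∞) := by
  rw [hammingNorm_sigma, Nat.cast_sum, Fintype.card_subtype, ← nsmul_eq_mul]
  refine le_trans ?_ (Finset.sum_le_sum_of_subset
    (Finset.subset_univ ({i | aeval (P i) f ≠ 0} : Finset (Fin h))))
  refine Finset.card_nsmul_le_sum _ _ _ fun i hi => (iInf_le _ i).trans ?_
  have hi' : evalPoint F (P i) f ≠ 0 := fun h0 => (Finset.mem_filter.1 hi).2 (by
    rw [← coe_evalPoint, h0]; rfl)
  refine minDist_le_hammingNorm (x := (π i (evalPoint F (P i) f) : Fin (n i) → F))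
    (Subtype.coe_prop _) ?_
  simpa using hi'

end Weights

end ExtCode

/-! ### The bound on the minimum distance. -/

theorem mainTheorem1
    -- the field `F = 𝔽_q`, its algebraic closure `Ω`, and an intermediate field `K`
    {F K Ω : Type*} [Field F] [Finite F] [Field K] [Field Ω]
    [Algebra F Ω] [IsAlgClosure F Ω]
    [Algebra F K] [Algebra K Ω] [IsScalarTower F K Ω]
    -- the ideal `I` and the ordering `≺_w`
    {m r : ℕ} (I : Ideal (MvPolynomial (Fin m) F))
    (w : (Fin m →₀ ℕ) →+ (Fin r →₀ ℕ))
    (ordN : MonomialOrder (Fin r)) (ordM : MonomialOrder (Fin m))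
    (hI : ExtCode.OrderDomainConditions w ordN ordM I)
    -- the points `P_1, …, P_h` and the ideal `I_P = I + J`
    {h : ℕ} (P : Fin h → Fin m → Ω) (hP : Function.Injective P)
    (J IP : Ideal (MvPolynomial (Fin m) K))
    (hIP : IP = I.map (MvPolynomial.map (algebraMap F K)) + J)
    (hzero : MvPolynomial.zeroLocus Ω IP = Set.range P)
    (hvanish : MvPolynomial.vanishingIdeal K (Set.range P) = IP)
    -- the space `L` with its well-behaving basis
    (L : Submodule F (MvPolynomial (Fin m) K ⧸ IP))
    {k : ℕ} (b : Fin k → MvPolynomial (Fin m) F)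
    (hb : ExtCode.IsWellBehavingBasis (ExtCode.weightedOrder w ordN ordM) IP L b)
    -- the inner `[n_i, r_i, d_i]` codes `C_i`, where `r_i = deg P_i`
    (n d : Fin h → ℕ) (C : ∀ i, Submodule F (Fin (n i) → F))
    (hd : ∀ i, ExtCode.minDist (C i) = d i)
    (π : ∀ i, ExtCode.gf F Ω (ExtCode.pointDegree F (P i)) ≃ₗ[F] C i) :
    (⨅ α ∈ ExtCode.square (ExtCode.weightedOrder w ordN ordM) b,
        (ExtCode.sigma (w '' ExtCode.footprint (ExtCode.weightedOrder w ordN ordM) IP)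
          (w '' ExtCode.footprint (ExtCode.weightedOrder w ordN ordM) I) (w α) : ℕ∞)) *
      (⨅ i, (d i : ℕ∞)) ≤
    ExtCode.minDist (ExtCode.extendedCode L P π) := by
  classical
  have hFΩ : Algebra.IsAlgebraic F Ω := IsAlgClosure.isAlgebraic
  have hclosed : IsAlgClosed Ω := IsAlgClosure.isAlgClosed F
  have : Algebra.IsAlgebraic F K := Algebra.IsAlgebraic.tower_bot F K Ω
  have : Algebra.IsAlgebraic K Ω := Algebra.IsAlgebraic.tower_top (K := F) K
  -- `K` is algebraic over a finite field, hence perfect; this makes `Ω / K` Galois, as the descent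
  -- requires.
  have : PerfectField K := Algebra.IsAlgebraic.perfectField F
  have : IsAlgClosure K Ω := ⟨hclosed, inferInstance⟩
  have : Normal K Ω := IsAlgClosure.normal K Ω
  have : IsGalois K Ω := {}
  set ord := ExtCode.weightedOrder w ordN ordM
  rw [ExtCode.minDist]
  refine le_iInf₂ fun x hx => le_iInf₂ fun y hy => le_iInf fun hxy => ?_
  rw [hammingDist_comm, hammingDist_eq_hammingNorm, neg_add_eq_sub]
  have hxy' := Submodule.sub_mem _ hx hy
  obtain ⟨f, hfL, hf⟩ := hxy'
  have hfL' : ExtCode.residue IP f ∈ L := hfL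
  rw [← hb.span_eq, Submodule.mem_span_range_iff_exists_fun] at hfL'
  obtain ⟨c, hc⟩ := hfL'
  -- `g` represents the same class as `f`, hence gives the same word, but is supported in the
  -- footprint of `IP`.
  set g := ∑ i, c i • b i with hg
  have hmem : MvPolynomial.map (algebraMap F K) (f - g) ∈ IP := by
    have h0 : ExtCode.residue IP (f - g) = 0 := by
      rw [map_sub, hg, map_sum, ← hc, sub_eq_zero]
      simp
    exact Ideal.Quotient.eq_zero_iff_mem.1 h0
  have hfg : ExtCode.evBar P π g = x - y := by
    rw [← hf]
    refine (ExtCode.evBar_congr P π fun i =>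
      ExtCode.aeval_eq_of_map_sub_mem (hzero ▸ Set.mem_range_self i) hmem).symm
  have hg0 : g ≠ 0 := by
    intro h0
    rw [h0, map_zero] at hfg
    exact hxy (sub_eq_zero.1 hfg.symm)
  have hc0 : c ≠ 0 := by
    rintro rfl
    exact hg0 (by simp [hg])
  have hb0 (i) : b i ≠ 0 := fun h0 => hb.linearIndependent.ne_zero i (by simp [h0])
  obtain ⟨i, -, hi⟩ := ord.exists_degree_sum_smul_eq hb0
    (fun i j hij => hb.strictMono_lm.injective (congrArg ord.toSyn hij)) hc0
  have hsupp : (g.support : Set (Fin m →₀ ℕ)) ⊆ ExtCode.footprint ord IP := by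
    intro a ha
    rw [Finset.mem_coe, MvPolynomial.mem_support_iff, hg, MvPolynomial.coeff_sum] at ha
    obtain ⟨j, -, hj⟩ := Finset.exists_ne_zero_of_sum_ne_zero ha
    rw [MvPolynomial.coeff_smul, smul_eq_mul] at hj
    exact hb.support_subset j (MvPolynomial.mem_support_iff.2 (right_ne_zero_of_mul hj))
  have hIJ : I.map (MvPolynomial.map (algebraMap F K)) ≤ IP := hIP ▸ le_sup_left
  have hσ := ExtCode.sigma_weight_degree_le_card hI hIJ (by rw [hzero, hvanish]) hP hzero hg0 hsupp
  have hw := ExtCode.card_mul_le_hammingNorm_evBar P π g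
  rw [← hfg]
  simp only [hd] at hw
  refine le_trans ?_ hw
  gcongr
  -- `lm(g)` is one of the `lm(b_i)`, so the minimum over `□(L)` is at most its `σ`.
  refine (iInf₂_le (ord.degree g) ⟨i, hi.symm⟩).trans ?_
  exact_mod_cast hσ
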